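/- **Setting.** Let $\mathcal X$ be a measurable space. A *classification DGP* $\mathcal D$ on $\mathcal X$ consists of a law of $x\in\mathcal X$ and a measurable $\eta^*:\mathcal X\to[0,1]$; a draw $z=(x,y)\sim\mathcal D$ has $y\in\{-1,1\}$ with $\mathbb P(y=1\mid x)=\eta^*(x)$. Its Bayes classifier is $f^*(x)=1$ if $\eta^*(x)\ge\frac12$ and $f^*(x)=-1$ otherwise, and its margin function is $\omega^*(x)=2\,\mathbb P(y=f^*(x)\mid x)-1$. For a sample $S_n=((x_i,y_i))_{i\le n}$, a class $\mathcal F$ of classifiers $\mathcal X\to\{-1,1\}$ and a weight $\omega:\mathcal X\to[0,1]$, a *weighted ERM* is any minimizer over $f\in\mathcal F$ of $\frac1n\sum_{i=1}^n\omega(x_i)\mathbb 1\{f(x_i)\ne y_i\}$. **Theorem.** There are absolute constants $\kappa,K>0$, a finite set $\mathcal X$ (with the discrete $\sigma$-algebra), a class $\mathcal F$ of functions $\mathcal X\to\{-1,1\}$ of finite VC dimension and a class $\mathcal G$ of functions $\mathcal X\to[0,1]$ of finite pseudo-dimension such that for every $c\in(0,1)$ and $p\in(0,1]$ there is a family $\Theta$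 of classification DGPs on $\mathcal X$ for which the following holds. 1. Every $\mathcal D\in\Theta$ satisfies $f^*\in\mathcal F$, $\eta^*\in\mathcal G$, $\omega^*(x)\in\{0\}\cup(c,1]$ for all $x\in\mathcal X$, and $\mathbb P(\omega^*(x)>c)=p$. 2. (Lower bound.) Let $0<\varepsilon\le\kappa pc^2$ and let $n\le\kappa/\varepsilon$ (in particular $n=\lfloor\kappa/\varepsilon\rfloor\asymp1/\varepsilon$ is allowed). For every learning rule $\hat f$, that is, every map from samples $S_n\in(\mathcal X\times\{-1,1\})^n$ to classifiers $\mathcal X\to\{-1,1\}$ (not necessarily in $\mathcal F$), there is $\mathcal D\in\Theta$ such that, with $S_n$ i.i.d. from $\mathcal D$ and $\hat f=\hat f(S_n)$, $$c\;\mathbb E_{S_n}\mathbb E_{z\sim\mathcal D}\big[\mathbb 1\{\hat f(x)\ne y\}-\mathbb 1\{f^*(x)\ne y\},\ \omega^*(x)\ge c\big]\ \ge\ \varepsilon$$ and $$\mathbb E_{S_n}\mathbb E_{z\sim\mathcal D}\big[\mathbb 1\{\hat f(x)\ne y\}-\mathbb 1\{f^*(x)\ne y\}\,\big|\,\omega^*(x)\ge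 c\big]\ \ge\ \frac{\varepsilon}{c\,\mathbb P(\omega^*(x)>c)}.$$ 3. (The bound is attained by weighted ERM, hence minimax tight up to constants.) Let $\mathcal D\in\Theta$, $\varepsilon>0$, $\delta\in(0,1)$ and $n\ge K\log(2/\delta)/\varepsilon$, and let $\omega:\mathcal X\to[0,1]$ be a fixed weight function with $\mathbb E_x[(\omega(x)-\omega^*(x))^2]\le\varepsilon$ (for instance $\omega=\omega^*$). Then with probability at least $1-\delta$ over $S_n$ i.i.d. from $\mathcal D$, every weighted ERM $\hat f$ over $\mathcal F$ with weight $\omega$ satisfies $$\mathbb E_{z\sim\mathcal D}\big[\mathbb 1\{\hat f(x)\ne y\}-\mathbb 1\{f^*(x)\ne y\}\,\big|\,\omega^*(x)\ge c\big]\ \le\ \frac{\varepsilon}{c\,\mathbb P(\omega^*(x)>c)}.$$ -/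

import Mathlib

open MeasureTheory ProbabilityTheory

noncomputable section

/-- `H` shatters the finite set `s`: every labelling of `s` is realised by a member of `H`. -/
def Shatters {α : Type*} (H : Set (α → Bool)) (s : Finset α) : Prop :=
  ∀ t ⊆ s, ∃ h ∈ H, ∀ x ∈ s, (h x = true ↔ x ∈ t)

/-- `H` has finite VC dimension. -/
def FiniteVCDim {α : Type*} (H : Set (α → Bool)) : Prop :=
  ∃ d : ℕ, ∀ s : Finset α, Shatters H s → s.card ≤ d

/-- A real-valued class has finite pseudo-dimension: the class of the indicator functions
`(x, t) ↦ [t ≤ g x]` of the subgraphs of its members has finite VC dimension. -/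
def FinitePseudoDim {X : Type*} (G : Set (X → ℝ)) : Prop :=
  FiniteVCDim {h : X × ℝ → Bool | ∃ g ∈ G, h = fun q => decide (q.2 ≤ g q.1)}

/-- A data generating process for binary classification: a law `μ` of the feature `x` and the
conditional probability `η x = P(y = 1 | x)`. The label `1` is encoded by `true` and the
label `-1` by `false`. -/
structure DGP (X : Type*) [MeasurableSpace X] where
  μ : Measure X
  prob : IsProbabilityMeasure μ
  η : X → ℝ
  measurable_η : Measurable η
  η_mem : ∀ x, η x ∈ Set.Icc (0 : ℝ) 1

namespace DGP

variable {X : Type*} [MeasurableSpace X]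

/-- `P(y = b | x)`. -/
def labelProb (D : DGP X) (x : X) (b : Bool) : ℝ := if b then D.η x else 1 - D.η x

/-- The joint law of `z = (x, y)`. -/
def joint (D : DGP X) : Measure (X × Bool) :=
  (D.μ.withDensity fun x => ENNReal.ofReal (D.labelProb x true)).map (fun x => (x, true)) +
    (D.μ.withDensity fun x => ENNReal.ofReal (D.labelProb x false)).map (fun x => (x, false))

instance (D : DGP X) : IsProbabilityMeasure D.joint := by
  have := D.prob
  have hη := D.measurable_η
  have ht : Measurable fun x : X => (x, true) := by fun_prop
  have hf : Measurable fun x : X => (x, false) := by fun_prop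
  constructor
  rw [joint, Measure.add_apply, Measure.map_apply ht .univ, Measure.map_apply hf .univ,
    Set.preimage_univ, Set.preimage_univ, withDensity_apply _ .univ, withDensity_apply _ .univ,
    Measure.restrict_univ, ← lintegral_add_left (by simp only [labelProb, ↓reduceIte]; fun_prop)]
  have h1 : ∀ x, ENNReal.ofReal (D.labelProb x true) + ENNReal.ofReal (D.labelProb x false) = 1 := by
    intro x
    have := D.η_mem x
    rw [← ENNReal.ofReal_add] <;> simp [labelProb, this.1, this.2]
  simp [h1]

/-- The law of `n` independent draws from the joint law. -/
def sample (D : DGP X) (n : ℕ) : Measure (Fin n → X × Bool) :=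
  Measure.pi fun _ => D.joint

/-- The Bayes classifier `f*`. -/
def bayes (D : DGP X) (x : X) : Bool := decide (1 / 2 ≤ D.η x)

/-- The margin function `ω*(x) = 2 P(y = f*(x) | x) - 1`. -/
def margin (D : DGP X) (x : X) : ℝ := 2 * D.labelProb x (D.bayes x) - 1

/-- The excess 0-1 loss of the classifier `f` at `z = (x, y)`. -/
def excessLoss (D : DGP X) (f : X → Bool) (z : X × Bool) : ℝ :=
  (if f z.1 ≠ z.2 then 1 else 0) - (if D.bayes z.1 ≠ z.2 then 1 else 0)

/-- `E[1{f(x) ≠ y} - 1{f*(x) ≠ y}, ω*(x) ≥ c]`. -/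
def excessOn (D : DGP X) (c : ℝ) (f : X → Bool) : ℝ :=
  ∫ z in {z | c ≤ D.margin z.1}, D.excessLoss f z ∂D.joint

/-- `E[1{f(x) ≠ y} - 1{f*(x) ≠ y} | ω*(x) ≥ c]`. -/
def condExcess (D : DGP X) (c : ℝ) (f : X → Bool) : ℝ :=
  ∫ z, D.excessLoss f z ∂(D.joint[|{z | c ≤ D.margin z.1}])

end DGP

/-- The empirical 0-1 risk on the sample `S`, weighted by `ω`. -/
def weightedRisk {X : Type*} {n : ℕ} (ω : X → ℝ) (S : Fin n → X × Bool) (f : X → Bool) : ℝ :=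
  (1 / (n : ℝ)) * ∑ i, ω (S i).1 * (if f (S i).1 ≠ (S i).2 then 1 else 0)

/-- `f` is a weighted empirical risk minimiser over `F` with weight `ω`. -/
def IsWeightedERM {X : Type*} {n : ℕ} (F : Set (X → Bool)) (ω : X → ℝ) (S : Fin n → X × Bool)
    (f : X → Bool) : Prop :=
  f ∈ F ∧ ∀ g ∈ F, weightedRisk ω S f ≤ weightedRisk ω S g

end

/-!
The lower bound is Le Cam's two-point method. The two processes differ only in which label is the
likelier one at a single point `x₀` of mass `q ≍ ε / c ^ 2` and margin `m ≍ c`, so the affinity of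
their joint laws is `1 - q * (1 - √(1 - m ^ 2))` and about `1 / (q * m ^ 2) ≍ 1 / ε` observations
are needed to tell them apart; a wrong guess at `x₀` costs `q * m ≍ ε / c`.

For the upper bound, members of the class agree off `x₀`. If the excess risk of a weighted ERM is
too large, then it is wrong at `x₀` and `ε < q * m ^ 2`. A weight within `ε` of the margin in mean
square then cannot vanish at `x₀`, hence the ERM errs only if the unlikely label is drawn at `x₀` at
least as often as the likely one, which by Chernoff has probability at most
`exp (-(n * q * m ^ 2 / 2))`.
-/

section FiniteClasses

variable {X : Type*}

theorem finiteVCDim_of_finite [Finite X] (H : Set (X → Bool)) : FiniteVCDim H := by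
  have := Fintype.ofFinite X
  exact ⟨Fintype.card X, fun s _ => s.card_le_univ⟩

theorem injOn_fst_of_shatters_subgraphs {G : Set (X → ℝ)} {s : Finset (X × ℝ)}
    (hs : Shatters {h : X × ℝ → Bool | ∃ g ∈ G, h = fun q => decide (q.2 ≤ g q.1)} s) :
    Set.InjOn Prod.fst (s : Set (X × ℝ)) := by
  -- The subgraph containing the upper of two points on a vertical line also contains the lower one.
  have snd_le {a b : X × ℝ} (ha : a ∈ s) (hb : b ∈ s) (hab : a.1 = b.1) : b.2 ≤ a.2 := by
    obtain ⟨-, ⟨g, -, rfl⟩, hg⟩ := hs {b} (by simpa using hb)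
    have hgb : b.2 ≤ g b.1 := by simpa using hg b hb
    by_contra! hlt
    have hmem : a ∈ ({b} : Finset (X × ℝ)) := (hg a ha).1 (decide_eq_true (hab ▸ hlt.le.trans hgb))
    exact hlt.ne (congrArg Prod.snd (Finset.mem_singleton.1 hmem))
  exact fun a ha b hb hab => Prod.ext hab (le_antisymm (snd_le hb ha hab.symm) (snd_le ha hb hab))

theorem finitePseudoDim_of_finite [Finite X] (G : Set (X → ℝ)) : FinitePseudoDim G := by
  classical
  have := Fintype.ofFinite X
  refine ⟨Fintype.card X, fun s hs => ?_⟩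
  rw [← Finset.card_image_of_injOn (injOn_fst_of_shatters_subgraphs hs)]
  exact Finset.card_le_univ _

/-- The classifiers whose value is pinned to the label `1` at every point but `x₀`: a class
in which learning amounts to guessing one label. -/
def trueOff (x₀ : X) : Set (X → Bool) := {f | ∀ x ≠ x₀, f x = true}

end FiniteClasses

theorem measureReal_pi_sum_nonneg_le_integral_exp_pow {Z ι : Type*} [MeasurableSpace Z] [Fintype ι]
    {ν : Measure Z} [SigmaFinite ν] {h : Z → ℝ} (hh : Integrable (fun z => Real.exp (h z)) ν) :
    (Measure.pi fun _ : ι => ν).real {S | 0 ≤ ∑ i, h (S i)} ≤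
      (∫ z, Real.exp (h z) ∂ν) ^ Fintype.card ι := by
  have markov := mul_meas_ge_le_integral_of_nonneg
    (.of_forall fun S => Finset.prod_nonneg fun i _ => (Real.exp_pos (h (S i))).le)
    (Integrable.fintype_prod fun _ : ι => hh) 1
  rw [one_mul, integral_fintype_prod_eq_pow fun z => Real.exp (h z)] at markov
  simpa only [← Real.exp_sum, Real.one_le_exp_iff] using markov

section Affinity

variable {Z : Type*} [Fintype Z] [MeasurableSpace Z]

/-- The Hellinger affinity of two measures on a finite space, with which Le Cam's method bounds
from below the error of any test between them. -/
noncomputable def affinity (P Q : Measure Z) : ℝ := ∑ z, √(P.real {z} * Q.real {z})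

theorem affinity_pi {ι : Type*} [Fintype ι] [DecidableEq ι] (P Q : ι → Measure Z)
    [∀ i, SigmaFinite (P i)] [∀ i, SigmaFinite (Q i)] :
    affinity (Measure.pi P) (Measure.pi Q) = ∏ i, affinity (P i) (Q i) := by
  simp only [affinity, Fintype.prod_sum, measureReal_def, Measure.pi_singleton, ENNReal.toReal_prod,
    ← Finset.prod_mul_distrib]
  exact Finset.sum_congr rfl fun S _ => Real.sqrt_prod _ fun _ _ => by positivity

theorem sum_measureReal_singleton_mem_or_notMem [MeasurableSingletonClass Z] (P Q : Measure Z)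
    [IsFiniteMeasure P] [IsFiniteMeasure Q] (W : Set Z) [DecidablePred (· ∈ W)] :
    ∑ z, (if z ∈ W then P.real {z} else Q.real {z}) = P.real W + Q.real Wᶜ := by
  classical
  rw [Finset.sum_ite, sum_measureReal_singleton, sum_measureReal_singleton]
  simp [Set.compl_def]

/-- Le Cam's inequality, by Cauchy-Schwarz for the measure equal to `P` on `W` and to `Q` on `Wᶜ`
against the measure with the roles of `P` and `Q` exchanged. -/
theorem affinity_sq_le [MeasurableSingletonClass Z] (P Q : Measure Z) [IsProbabilityMeasure P]
    [IsProbabilityMeasure Q] (W : Set Z) :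
    affinity P Q ^ 2 ≤ 2 * (P.real W + Q.real Wᶜ) := by
  classical
  let u (z : Z) : ℝ := if z ∈ W then P.real {z} else Q.real {z}
  let v (z : Z) : ℝ := if z ∈ W then Q.real {z} else P.real {z}
  have hu (z : Z) : 0 ≤ u z := by dsimp only [u]; split_ifs <;> positivity
  have hv (z : Z) : 0 ≤ v z := by dsimp only [v]; split_ifs <;> positivity
  have affinity_eq : affinity P Q = ∑ z, √(u z) * √(v z) := by
    refine Finset.sum_congr rfl fun z _ => ?_
    rw [← Real.sqrt_mul (hu z)]
    by_cases hz : z ∈ W <;> simp [u, v, hz, mul_comm]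
  have sum_v_le : ∑ z, v z ≤ 2 := by
    rw [sum_measureReal_singleton_mem_or_notMem]
    linarith [measureReal_le_one (μ := Q) (s := W), measureReal_le_one (μ := P) (s := Wᶜ)]
  calc affinity P Q ^ 2 ≤ (√(∑ z, u z) * √(∑ z, v z)) ^ 2 := by
        rw [affinity_eq]
        gcongr
        exact Real.sum_sqrt_mul_sqrt_le _ hu hv
    _ = (∑ z, u z) * ∑ z, v z := by
        rw [mul_pow, Real.sq_sqrt (Finset.sum_nonneg fun z _ => hu z),
          Real.sq_sqrt (Finset.sum_nonneg fun z _ => hv z)]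
    _ ≤ (∑ z, u z) * 2 := by gcongr
    _ = 2 * (P.real W + Q.real Wᶜ) := by
        rw [sum_measureReal_singleton_mem_or_notMem, mul_comm]

end Affinity

namespace DGP

section General

variable {X : Type*} [MeasurableSpace X]

theorem labelProb_nonneg (D : DGP X) (x : X) (b : Bool) : 0 ≤ D.labelProb x b := by
  have := D.η_mem x
  cases b <;> simp [labelProb, this.1, this.2]

theorem sum_labelProb (D : DGP X) (x : X) : ∑ b, D.labelProb x b = 1 := by
  simp [labelProb]

theorem measurable_labelProb (D : DGP X) (b : Bool) : Measurable fun x => D.labelProb x b := by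
  have := D.measurable_η
  cases b <;> simp only [labelProb, Bool.false_eq_true, if_true, if_false] <;> fun_prop

theorem margin_eq_abs (D : DGP X) (x : X) : D.margin x = |2 * D.η x - 1| := by
  by_cases h : 1 / 2 ≤ D.η x
  · rw [abs_of_nonneg (by linarith)]
    simp only [margin, labelProb, bayes, decide_eq_true h, if_true]
  · rw [abs_of_neg (by linarith)]
    simp only [margin, labelProb, bayes, decide_eq_false h, Bool.false_eq_true, if_false]
    ring

theorem margin_nonneg (D : DGP X) (x : X) : 0 ≤ D.margin x :=
  D.margin_eq_abs x ▸ abs_nonneg _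

theorem margin_le_one (D : DGP X) (x : X) : D.margin x ≤ 1 := by
  obtain ⟨h0, h1⟩ := D.η_mem x
  rw [margin_eq_abs, abs_le]
  constructor <;> linarith

theorem measurable_margin (D : DGP X) : Measurable D.margin := by
  have := D.measurable_η
  simp only [funext D.margin_eq_abs]
  fun_prop

theorem integrable_margin (D : DGP X) : Integrable D.margin D.μ := by
  have := D.prob
  refine .of_bound D.measurable_margin.aestronglyMeasurable 1 (.of_forall fun x => ?_)
  rw [Real.norm_of_nonneg (D.margin_nonneg x)]
  exact D.margin_le_one x

theorem measurable_bayes (D : DGP X) : Measurable D.bayes :=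
  measurable_to_bool <| by
    simpa [Set.preimage, bayes] using measurableSet_le measurable_const D.measurable_η

theorem labelProb_eq (D : DGP X) (x : X) (b : Bool) :
    D.labelProb x b = if b = D.bayes x then (1 + D.margin x) / 2 else (1 - D.margin x) / 2 := by
  unfold margin
  cases b <;> cases D.bayes x <;> simp [labelProb] <;> ring

theorem map_fst_joint (D : DGP X) : D.joint.map Prod.fst = D.μ := by
  have hlab (b : Bool) : Measurable fun x : X => (x, b) := by fun_prop
  have hid (b : Bool) : Prod.fst ∘ (fun x : X => (x, b)) = id := rfl
  rw [joint, Measure.map_add _ _ measurable_fst, Measure.map_map measurable_fst (hlab _),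
    Measure.map_map measurable_fst (hlab _), hid, hid, Measure.map_id, Measure.map_id,
    ← withDensity_add_left (D.measurable_labelProb true).ennreal_ofReal]
  convert withDensity_one
  ext x
  rw [Pi.add_apply, ← ENNReal.ofReal_add (D.labelProb_nonneg x _) (D.labelProb_nonneg x _),
    ← Fintype.sum_bool (D.labelProb x), sum_labelProb, ENNReal.ofReal_one, Pi.one_apply]

theorem joint_real_preimage_fst (D : DGP X) {s : Set X} (hs : MeasurableSet s) :
    D.joint.real (Prod.fst ⁻¹' s) = D.μ.real s := by
  rw [← map_measureReal_apply measurable_fst hs, map_fst_joint]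

theorem joint_real_singleton [MeasurableSingletonClass X] (D : DGP X) (x : X) (b : Bool) :
    D.joint.real {(x, b)} = D.μ.real {x} * D.labelProb x b := by
  have := D.prob
  have hlab (b : Bool) : Measurable fun x : X => (x, b) := by fun_prop
  have hpre (b' : Bool) : (fun x' : X => (x', b')) ⁻¹' {(x, b)} = if b' = b then {x} else ∅ := by
    ext y
    by_cases h : b' = b <;> simp [h]
  rw [measureReal_def, joint, Measure.add_apply, Measure.map_apply (hlab _) (.singleton _),
    Measure.map_apply (hlab _) (.singleton _), hpre, hpre]
  cases b <;> simp [withDensity_apply, measureReal_def, labelProb_nonneg, mul_comm]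

theorem integral_joint (D : DGP X) {φ : X × Bool → ℝ} (hφ : Integrable φ D.joint) :
    ∫ z, φ z ∂D.joint = ∫ x, ∑ b, D.labelProb x b * φ (x, b) ∂D.μ := by
  have integral_label (b : Bool) (hφb : Integrable φ
        ((D.μ.withDensity fun x => ENNReal.ofReal (D.labelProb x b)).map fun x => (x, b))) :
      Integrable (fun x => D.labelProb x b * φ (x, b)) D.μ ∧
      ∫ z, φ z ∂(D.μ.withDensity fun x => ENNReal.ofReal (D.labelProb x b)).map (fun x => (x, b)) =
        ∫ x, D.labelProb x b * φ (x, b) ∂D.μ := by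
    have hlab : Measurable fun x : X => (x, b) := by fun_prop
    have hdens := (D.measurable_labelProb b).ennreal_ofReal
    have hfin : ∀ᵐ x ∂D.μ, ENNReal.ofReal (D.labelProb x b) < ⊤ :=
      .of_forall fun _ => ENNReal.ofReal_lt_top
    constructor
    · simpa [ENNReal.toReal_ofReal, labelProb_nonneg] using
        (integrable_withDensity_iff_integrable_smul' hdens hfin).1 (hφb.comp_measurable hlab)
    · rw [integral_map hlab.aemeasurable hφb.aestronglyMeasurable,
        integral_withDensity_eq_integral_toReal_smul hdens hfin]
      simp [ENNReal.toReal_ofReal, labelProb_nonneg]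
  obtain ⟨int_true, eq_true⟩ := integral_label true hφ.left_of_add_measure
  obtain ⟨int_false, eq_false⟩ := integral_label false hφ.right_of_add_measure
  simp only [Fintype.sum_bool]
  rw [joint, integral_add_measure hφ.left_of_add_measure hφ.right_of_add_measure, eq_true,
    eq_false, integral_add int_true int_false]

instance (D : DGP X) (n : ℕ) : IsProbabilityMeasure (D.sample n) := by
  unfold sample
  infer_instance

theorem excessLoss_eq_zero (D : DGP X) {f : X → Bool} {z : X × Bool} (h : f z.1 = D.bayes z.1) :
    D.excessLoss f z = 0 := by
  simp [excessLoss, h]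

theorem abs_excessLoss_le_one (D : DGP X) (f : X → Bool) (z : X × Bool) :
    |D.excessLoss f z| ≤ 1 := by
  unfold excessLoss
  split_ifs <;> simp

theorem measurable_excessLoss (D : DGP X) {f : X → Bool} (hf : Measurable f) :
    Measurable (D.excessLoss f) := by
  have ne_label {g : X → Bool} (hg : Measurable g) : MeasurableSet {z : X × Bool | g z.1 ≠ z.2} :=
    (measurableSet_eq_fun (hg.comp measurable_fst) measurable_snd).compl
  exact .sub (.ite (ne_label hf) measurable_const measurable_const)
    (.ite (ne_label D.measurable_bayes) measurable_const measurable_const)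

theorem integrable_exp_mul_excessLoss (D : DGP X) {f : X → Bool} (hf : Measurable f) (t : ℝ) :
    Integrable (fun z => Real.exp (-(t * D.excessLoss f z))) D.joint := by
  have hmeas := D.measurable_excessLoss hf
  refine .of_bound (C := Real.exp |t|) (by fun_prop) (.of_forall fun z => ?_)
  rw [Real.norm_eq_abs, Real.abs_exp, Real.exp_le_exp]
  calc -(t * D.excessLoss f z) ≤ |t * D.excessLoss f z| := neg_le_abs _
    _ ≤ |t| := by
      rw [abs_mul]
      exact mul_le_of_le_one_right (abs_nonneg t) (D.abs_excessLoss_le_one f z)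

theorem sum_labelProb_mul_excessLoss (D : DGP X) (f : X → Bool) (x : X) :
    ∑ b, D.labelProb x b * D.excessLoss f (x, b) = if f x = D.bayes x then 0 else D.margin x := by
  simp only [Fintype.sum_bool, excessLoss, labelProb_eq]
  cases f x <;> cases D.bayes x <;> simp <;> ring

theorem excessOn_eq_setIntegral_margin (D : DGP X) (c : ℝ) {f : X → Bool} (hf : Measurable f) :
    D.excessOn c f = ∫ x in {x | c ≤ D.margin x ∧ f x ≠ D.bayes x}, D.margin x ∂D.μ := by
  have hregion : MeasurableSet {x | c ≤ D.margin x} :=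
    measurableSet_le measurable_const D.measurable_margin
  have hwrong : MeasurableSet {x | c ≤ D.margin x ∧ f x ≠ D.bayes x} :=
    hregion.inter (measurableSet_eq_fun hf D.measurable_bayes).compl
  have hlift : MeasurableSet {z : X × Bool | c ≤ D.margin z.1} := measurable_fst hregion
  have hint : Integrable (D.excessLoss f) D.joint :=
    .of_bound (D.measurable_excessLoss hf).aestronglyMeasurable 1
      (.of_forall (D.abs_excessLoss_le_one f))
  rw [excessOn, ← integral_indicator hlift, D.integral_joint (hint.indicator hlift),
    ← integral_indicator hwrong]
  refine integral_congr_ae (.of_forall fun x => ?_)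
  by_cases hx : c ≤ D.margin x
  · by_cases hfx : f x = D.bayes x <;>
      simpa [Set.indicator, hx, hfx] using D.sum_labelProb_mul_excessLoss f x
  · simp [Set.indicator, hx]

theorem excessOn_nonneg (D : DGP X) (c : ℝ) {f : X → Bool} (hf : Measurable f) :
    0 ≤ D.excessOn c f := by
  rw [D.excessOn_eq_setIntegral_margin c hf]
  exact integral_nonneg D.margin_nonneg

theorem condExcess_eq_div (D : DGP X) (c : ℝ) (f : X → Bool) :
    D.condExcess c f = D.excessOn c f / D.μ.real {x | c ≤ D.margin x} := by
  rw [condExcess, excessOn, ProbabilityTheory.cond, integral_smul_measure, smul_eq_mul,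
    ENNReal.toReal_inv, inv_mul_eq_div, ← joint_real_preimage_fst D
      (measurableSet_le measurable_const D.measurable_margin)]
  rfl

theorem sum_labelProb_mul_exp_le (D : DGP X) {f : X → Bool} {m : ℝ} (hm : 0 ≤ m) {x : X}
    (hx : f x ≠ D.bayes x → m ≤ D.margin x) :
    ∑ b, D.labelProb x b * Real.exp (-(Real.log (1 + m) * D.excessLoss f (x, b))) ≤
      1 - {x | f x ≠ D.bayes x}.indicator (fun _ => m ^ 2 / 2) x := by
  by_cases hfx : f x = D.bayes x
  · have hloss (b : Bool) : D.excessLoss f (x, b) = 0 := D.excessLoss_eq_zero hfx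
    simp only [hloss, mul_zero, neg_zero, Real.exp_zero, mul_one, sum_labelProb]
    simp [hfx]
  · have hexp : Real.exp (Real.log (1 + m)) = 1 + m := Real.exp_log (by linarith)
    have hsum : ∑ b, D.labelProb x b * Real.exp (-(Real.log (1 + m) * D.excessLoss f (x, b))) =
        (1 + D.margin x) / 2 * (1 + m)⁻¹ + (1 - D.margin x) / 2 * (1 + m) := by
      simp only [Fintype.sum_bool, excessLoss, labelProb_eq]
      cases hf : f x <;> cases hb : D.bayes x <;>
        simp_all [Real.exp_neg, add_comm]
    -- The left side decreases in the margin, and equals the right side when the margin is `m`.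
    have hdecr : (1 + D.margin x) / 2 * (1 + m)⁻¹ + (1 - D.margin x) / 2 * (1 + m) ≤
        1 - m ^ 2 / 2 := by
      have hinv : (1 + m)⁻¹ ≤ 1 + m := (inv_le_one_of_one_le₀ (by linarith)).trans (by linarith)
      have hcancel : (1 + m) * (1 + m)⁻¹ = 1 := mul_inv_cancel₀ (by linarith)
      nlinarith [mul_nonneg (sub_nonneg.2 (hx hfx)) (sub_nonneg.2 hinv)]
    rw [hsum, Set.indicator_of_mem (show x ∈ {x | f x ≠ D.bayes x} from hfx)]
    exact hdecr

theorem integral_exp_excessLoss_le (D : DGP X) {f : X → Bool} (hf : Measurable f) {m : ℝ}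
    (hm : 0 ≤ m) (hfm : ∀ x, f x ≠ D.bayes x → m ≤ D.margin x) :
    ∫ z, Real.exp (-(Real.log (1 + m) * D.excessLoss f z)) ∂D.joint ≤
      1 - D.μ.real {x | f x ≠ D.bayes x} * (m ^ 2 / 2) := by
  have := D.prob
  have hwrong : MeasurableSet {x | f x ≠ D.bayes x} :=
    (measurableSet_eq_fun hf D.measurable_bayes).compl
  have hind : Integrable ({x | f x ≠ D.bayes x}.indicator fun _ => m ^ 2 / 2) D.μ :=
    (integrable_const _).indicator hwrong
  calc _ = ∫ x, ∑ b, D.labelProb x b *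
        Real.exp (-(Real.log (1 + m) * D.excessLoss f (x, b))) ∂D.μ :=
        D.integral_joint (D.integrable_exp_mul_excessLoss hf _)
    _ ≤ ∫ x, (1 - {x | f x ≠ D.bayes x}.indicator (fun _ => m ^ 2 / 2) x) ∂D.μ :=
        integral_mono_of_nonneg
          (.of_forall fun x => Finset.sum_nonneg fun b _ =>
            mul_nonneg (D.labelProb_nonneg x b) (Real.exp_pos _).le)
          ((integrable_const 1).sub hind)
          (.of_forall fun x => D.sum_labelProb_mul_exp_le hm (hfm x))
    _ = _ := by
        rw [integral_sub (integrable_const 1) hind, integral_indicator_const _ hwrong]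
        simp

theorem sample_real_sum_excessLoss_nonpos_le (D : DGP X) {f : X → Bool} (hf : Measurable f) {m : ℝ}
    (hm : 0 ≤ m) (hfm : ∀ x, f x ≠ D.bayes x → m ≤ D.margin x) (n : ℕ) :
    (D.sample n).real {S | ∑ i, D.excessLoss f (S i) ≤ 0} ≤
      Real.exp (-(n * (D.μ.real {x | f x ≠ D.bayes x} * (m ^ 2 / 2)))) := by
  have hlog : 0 ≤ Real.log (1 + m) := Real.log_nonneg (by linarith)
  calc (D.sample n).real {S | ∑ i, D.excessLoss f (S i) ≤ 0}
    _ ≤ (D.sample n).real {S | 0 ≤ ∑ i, -(Real.log (1 + m) * D.excessLoss f (S i))} :=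
        measureReal_mono fun S (hS : ∑ i, D.excessLoss f (S i) ≤ 0) => by
          rw [Set.mem_ofPred_eq, Finset.sum_neg_distrib, ← Finset.mul_sum]
          exact neg_nonneg.2 (mul_nonpos_of_nonneg_of_nonpos hlog hS)
    _ ≤ (∫ z, Real.exp (-(Real.log (1 + m) * D.excessLoss f z)) ∂D.joint) ^ n := by
        simpa only [sample, Fintype.card_fin] using measureReal_pi_sum_nonneg_le_integral_exp_pow
          (ι := Fin n) (D.integrable_exp_mul_excessLoss hf (Real.log (1 + m)))
    _ ≤ Real.exp (-(D.μ.real {x | f x ≠ D.bayes x} * (m ^ 2 / 2))) ^ n :=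
        pow_le_pow_left₀ (integral_nonneg fun _ => (Real.exp_pos _).le)
          ((D.integral_exp_excessLoss_le hf hm hfm).trans (Real.one_sub_le_exp_neg _)) n
    _ = _ := by rw [← Real.exp_nat_mul, mul_neg]

theorem sum_mul_excessLoss_nonpos_of_isWeightedERM (D : DGP X) {F : Set (X → Bool)}
    (hbayes : D.bayes ∈ F) {n : ℕ} {ω : X → ℝ} {S : Fin n → X × Bool} {f : X → Bool}
    (hf : IsWeightedERM F ω S f) : ∑ i, ω (S i).1 * D.excessLoss f (S i) ≤ 0 := by
  rcases n.eq_zero_or_pos with rfl | hn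
  · simp
  · have hle := hf.2 D.bayes hbayes
    rw [weightedRisk, weightedRisk, mul_le_mul_iff_right₀ (by positivity)] at hle
    simpa only [excessLoss, mul_sub, Finset.sum_sub_distrib, sub_nonpos] using hle

theorem sum_excessLoss_nonpos_of_isWeightedERM (D : DGP X) {F : Set (X → Bool)}
    (hbayes : D.bayes ∈ F) {x₀ : X} {n : ℕ} {ω : X → ℝ} (hω : 0 < ω x₀) {S : Fin n → X × Bool}
    {f : X → Bool} (hf : IsWeightedERM F ω S f) (hoff : ∀ x ≠ x₀, f x = D.bayes x) :
    ∑ i, D.excessLoss f (S i) ≤ 0 := by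
  have hterm (z : X × Bool) : ω z.1 * D.excessLoss f z = ω x₀ * D.excessLoss f z := by
    by_cases hz : z.1 = x₀
    · rw [hz]
    · rw [D.excessLoss_eq_zero (hoff z.1 hz), mul_zero, mul_zero]
  have hsum := D.sum_mul_excessLoss_nonpos_of_isWeightedERM hbayes hf
  simp only [hterm, ← Finset.mul_sum] at hsum
  exact nonpos_of_mul_nonpos_right hsum hω

end General

section SinglePoint

variable {X : Type*} [MeasurableSpace X] [MeasurableSingletonClass X]

theorem mul_margin_le_excessOn (D : DGP X) {c : ℝ} {x₀ : X} (hc : c ≤ D.margin x₀)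
    {f : X → Bool} (hf : Measurable f) (hfx₀ : f x₀ ≠ D.bayes x₀) :
    D.μ.real {x₀} * D.margin x₀ ≤ D.excessOn c f := by
  have := D.prob
  rw [D.excessOn_eq_setIntegral_margin c hf, ← smul_eq_mul, ← integral_singleton]
  have hsub : {x₀} ⊆ {x | c ≤ D.margin x ∧ f x ≠ D.bayes x} :=
    Set.singleton_subset_iff.2 ⟨hc, hfx₀⟩
  exact setIntegral_mono_set D.integrable_margin.integrableOn (.of_forall D.margin_nonneg)
    hsub.eventuallyLE

theorem excessOn_eq_ite_of_eq_off (D : DGP X) (c : ℝ) {x₀ : X} {f : X → Bool}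
    (hf : ∀ x ≠ x₀, f x = D.bayes x) :
    D.excessOn c f =
      if c ≤ D.margin x₀ ∧ f x₀ ≠ D.bayes x₀ then D.μ.real {x₀} * D.margin x₀ else 0 := by
  have hmeas : Measurable f := D.measurable_bayes.measurable_of_countable_ne <|
    (Set.countable_singleton x₀).mono fun x hx => by_contra fun hne => hx (hf x hne).symm
  rw [D.excessOn_eq_setIntegral_margin c hmeas]
  have eq_of_wrong {x : X} (hx : f x ≠ D.bayes x) : x = x₀ := by_contra fun hne => hx (hf x hne)
  split_ifs with h
  · have hset : {x | c ≤ D.margin x ∧ f x ≠ D.bayes x} = {x₀} :=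
      Set.eq_singleton_iff_unique_mem.2 ⟨h, fun x hx => eq_of_wrong hx.2⟩
    rw [hset, integral_singleton, smul_eq_mul]
  · have hset : {x | c ≤ D.margin x ∧ f x ≠ D.bayes x} = ∅ :=
      Set.eq_empty_of_forall_notMem fun x hx => h (eq_of_wrong hx.2 ▸ hx)
    rw [hset, setIntegral_empty]

open Classical in
/-- The process obtained from `D` by exchanging the two labels at the single point `x₀`. It is the
alternative to `D` in Le Cam's two-point argument. -/
noncomputable def flipAt (D : DGP X) (x₀ : X) : DGP X where
  μ := D.μ
  prob := D.prob
  η x := if x = x₀ then 1 - D.η x else D.η x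
  measurable_η := .ite (.singleton x₀) (D.measurable_η.const_sub 1) D.measurable_η
  η_mem x := by
    obtain ⟨h0, h1⟩ := D.η_mem x
    split_ifs <;> constructor <;> linarith

theorem flipAt_μ (D : DGP X) (x₀ : X) : (D.flipAt x₀).μ = D.μ := rfl

theorem labelProb_flipAt_of_ne (D : DGP X) {x₀ x : X} (hx : x ≠ x₀) (b : Bool) :
    (D.flipAt x₀).labelProb x b = D.labelProb x b := by
  simp [labelProb, flipAt, hx]

theorem labelProb_flipAt_self (D : DGP X) (x₀ : X) (b : Bool) :
    (D.flipAt x₀).labelProb x₀ b = D.labelProb x₀ !b := by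
  cases b <;> simp [labelProb, flipAt]

theorem margin_flipAt (D : DGP X) (x₀ : X) : (D.flipAt x₀).margin = D.margin := by
  funext x
  rw [margin_eq_abs, margin_eq_abs]
  by_cases hx : x = x₀
  · rw [← abs_neg]
    simp only [flipAt, hx, if_true]
    ring_nf
  · simp only [flipAt, hx, if_false]

theorem bayes_flipAt_of_ne (D : DGP X) {x₀ x : X} (hx : x ≠ x₀) :
    (D.flipAt x₀).bayes x = D.bayes x := by
  simp [bayes, flipAt, hx]

theorem bayes_flipAt_self (D : DGP X) {x₀ : X} (hm : 0 < D.margin x₀) :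
    (D.flipAt x₀).bayes x₀ = !D.bayes x₀ := by
  rw [margin_eq_abs, abs_pos] at hm
  have hne : D.η x₀ ≠ 1 / 2 := fun h => hm (by rw [h]; norm_num)
  rcases hne.lt_or_gt with h | h
  · simp only [bayes, flipAt, if_true, decide_eq_true (show 1 / 2 ≤ 1 - D.η x₀ by linarith),
      decide_eq_false h.not_ge, Bool.not_false]
  · simp only [bayes, flipAt, if_true, decide_eq_false (show ¬1 / 2 ≤ 1 - D.η x₀ by linarith),
      decide_eq_true h.le, Bool.not_true]

theorem eq_bayes_flipAt (D : DGP X) {x₀ : X} (hm : 0 < D.margin x₀) {f : X → Bool}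
    (hf : ∀ x ≠ x₀, f x = D.bayes x) (hfx₀ : f x₀ ≠ D.bayes x₀) : f = (D.flipAt x₀).bayes := by
  funext x
  by_cases hx : x = x₀
  · rw [hx, D.bayes_flipAt_self hm, Bool.eq_not_of_ne hfx₀]
  · rw [hf x hx, D.bayes_flipAt_of_ne hx]

theorem bayes_flipAt_ne_iff (D : DGP X) {x₀ : X} (hm : 0 < D.margin x₀) {x : X} :
    (D.flipAt x₀).bayes x ≠ D.bayes x ↔ x = x₀ := by
  refine ⟨fun h => by_contra fun hx => h (D.bayes_flipAt_of_ne hx), ?_⟩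
  rintro rfl
  simp [D.bayes_flipAt_self hm]

theorem ne_bayes_and_lt_of_lt_condExcess (D : DGP X) {c ε : ℝ} (hc : 0 < c) (hε : 0 ≤ ε) {x₀ : X}
    {f : X → Bool} (hf : ∀ x ≠ x₀, f x = D.bayes x)
    (hlt : ε / (c * D.μ.real {x | c ≤ D.margin x}) < D.condExcess c f) :
    f x₀ ≠ D.bayes x₀ ∧ ε < D.μ.real {x₀} * D.margin x₀ ^ 2 := by
  rw [condExcess_eq_div, D.excessOn_eq_ite_of_eq_off c hf] at hlt
  have mass_pos : 0 < D.μ.real {x | c ≤ D.margin x} :=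
    measureReal_nonneg.lt_of_ne' fun h => by simp [h] at hlt
  rw [← div_div, div_lt_div_iff_of_pos_right mass_pos, div_lt_iff₀' hc] at hlt
  split_ifs at hlt with hwrong
  · refine ⟨hwrong.2, hlt.trans_le ?_⟩
    calc c * (D.μ.real {x₀} * D.margin x₀) ≤ D.margin x₀ * (D.μ.real {x₀} * D.margin x₀) :=
          mul_le_mul_of_nonneg_right hwrong.1 (mul_nonneg measureReal_nonneg (D.margin_nonneg x₀))
      _ = D.μ.real {x₀} * D.margin x₀ ^ 2 := by ring
  · linarith

theorem pos_of_integral_sq_sub_margin_lt (D : DGP X) {ω : X → ℝ} {x₀ : X} (hω : 0 ≤ ω x₀)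
    (hint : Integrable (fun x => (ω x - D.margin x) ^ 2) D.μ)
    (hlt : ∫ x, (ω x - D.margin x) ^ 2 ∂D.μ < D.μ.real {x₀} * D.margin x₀ ^ 2) : 0 < ω x₀ := by
  refine hω.lt_of_ne' fun hzero => hlt.not_ge ?_
  calc D.μ.real {x₀} * D.margin x₀ ^ 2 = ∫ x in {x₀}, (ω x - D.margin x) ^ 2 ∂D.μ := by
        rw [integral_singleton, hzero, zero_sub, neg_sq, smul_eq_mul]
    _ ≤ ∫ x, (ω x - D.margin x) ^ 2 ∂D.μ :=
        setIntegral_le_integral hint (.of_forall fun x => sq_nonneg _)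

theorem sample_real_lt_condExcess_weightedERM_le (D : DGP X) {F : Set (X → Bool)}
    (hbayes : D.bayes ∈ F) {x₀ : X} (hF : ∀ f ∈ F, ∀ x ≠ x₀, f x = D.bayes x) {c ε : ℝ}
    (hc : 0 < c) (hε : 0 < ε) (n : ℕ) :
    (D.sample n).real {S | ∃ ω f, (∀ x, 0 ≤ ω x) ∧
        Integrable (fun x => (ω x - D.margin x) ^ 2) D.μ ∧
        ∫ x, (ω x - D.margin x) ^ 2 ∂D.μ ≤ ε ∧ IsWeightedERM F ω S f ∧
        ε / (c * D.μ.real {x | c ≤ D.margin x}) < D.condExcess c f} ≤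
      Real.exp (-(n * ε / 2)) := by
  by_cases hεx₀ : ε < D.μ.real {x₀} * D.margin x₀ ^ 2
  · have hm : 0 < D.margin x₀ := (D.margin_nonneg x₀).lt_of_ne' fun h => by
      rw [h] at hεx₀
      linarith
    let f₁ := (D.flipAt x₀).bayes
    have hwrong : {x | f₁ x ≠ D.bayes x} = {x₀} := Set.ext fun x => D.bayes_flipAt_ne_iff hm
    have hmargin (x : X) (hx : f₁ x ≠ D.bayes x) : D.margin x₀ ≤ D.margin x :=
      (D.bayes_flipAt_ne_iff hm).1 hx ▸ le_rfl
    calc _ ≤ (D.sample n).real {S | ∑ i, D.excessLoss f₁ (S i) ≤ 0} := by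
          refine measureReal_mono ?_
          rintro S ⟨ω, f, hω, hint, hωε, hf, hlt⟩
          have hoff := hF f hf.1
          have hf₁ : f = f₁ :=
            D.eq_bayes_flipAt hm hoff (D.ne_bayes_and_lt_of_lt_condExcess hc hε.le hoff hlt).1
          have hωx₀ : 0 < ω x₀ :=
            D.pos_of_integral_sq_sub_margin_lt (hω x₀) hint (hωε.trans_lt hεx₀)
          exact hf₁ ▸ D.sum_excessLoss_nonpos_of_isWeightedERM hbayes hωx₀ hf hoff
      _ ≤ Real.exp (-(n * (D.μ.real {x | f₁ x ≠ D.bayes x} * (D.margin x₀ ^ 2 / 2)))) :=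
          D.sample_real_sum_excessLoss_nonpos_le (D.flipAt x₀).measurable_bayes hm.le hmargin n
      _ ≤ Real.exp (-(n * ε / 2)) := by
          rw [hwrong, ← mul_div_assoc, ← mul_div_assoc]
          gcongr
  · refine (measureReal_mono (s₂ := ∅) ?_).trans (measureReal_empty.trans_le (Real.exp_pos _).le)
    rintro S ⟨ω, f, -, -, -, hf, hlt⟩
    exact hεx₀ (D.ne_bayes_and_lt_of_lt_condExcess hc hε.le (hF f hf.1) hlt).2

theorem affinity_joint_flipAt [Fintype X] (D : DGP X) (x₀ : X) :
    affinity D.joint (D.flipAt x₀).joint =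
      1 - D.μ.real {x₀} * (1 - √(1 - D.margin x₀ ^ 2)) := by
  classical
  have := D.prob
  have hpoint (x : X) : ∑ b, √(D.joint.real {(x, b)} * (D.flipAt x₀).joint.real {(x, b)}) =
      D.μ.real {x} - if x = x₀ then D.μ.real {x₀} * (1 - √(1 - D.margin x₀ ^ 2)) else 0 := by
    have hfactor (b : Bool) : √(D.joint.real {(x, b)} * (D.flipAt x₀).joint.real {(x, b)}) =
        D.μ.real {x} * √(D.labelProb x b * (D.flipAt x₀).labelProb x b) := by
      rw [joint_real_singleton, joint_real_singleton, flipAt_μ, mul_mul_mul_comm,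
        Real.sqrt_mul (mul_self_nonneg _), Real.sqrt_mul_self measureReal_nonneg]
    simp only [hfactor, ← Finset.mul_sum]
    split_ifs with hx
    · subst hx
      have hprod (b : Bool) : D.labelProb x b * D.labelProb x (!b) =
          (1 - D.margin x ^ 2) / 2 ^ 2 := by
        rw [labelProb_eq, labelProb_eq]
        cases b <;> cases D.bayes x <;> simp <;> ring
      simp only [labelProb_flipAt_self, hprod, Real.sqrt_div', Finset.sum_const, Finset.card_univ,
        Fintype.card_bool, sq_nonneg, Real.sqrt_sq zero_le_two]
      ring
    · simp only [D.labelProb_flipAt_of_ne hx, Real.sqrt_mul_self (D.labelProb_nonneg x _),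
        sum_labelProb, mul_one, sub_zero]
  rw [affinity, Fintype.sum_prod_type, Finset.sum_congr rfl fun x _ => hpoint x,
    Finset.sum_sub_distrib, sum_measureReal_singleton, Finset.coe_univ, probReal_univ,
    Finset.sum_ite_eq' Finset.univ, if_pos (Finset.mem_univ _)]

theorem one_sub_le_affinity_sample_flipAt [Fintype X] (D : DGP X) (x₀ : X) (n : ℕ) :
    1 - n * (D.μ.real {x₀} * D.margin x₀ ^ 2) ≤
      affinity (D.sample n) ((D.flipAt x₀).sample n) := by
  have := D.prob
  have hm0 := D.margin_nonneg x₀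
  have hm1 : D.margin x₀ ^ 2 ≤ 1 := pow_le_one₀ hm0 (D.margin_le_one x₀)
  have hinfo : D.μ.real {x₀} * D.margin x₀ ^ 2 ≤ 1 :=
    mul_le_one₀ measureReal_le_one (sq_nonneg _) hm1
  have hsqrt : 1 - D.margin x₀ ^ 2 ≤ √(1 - D.margin x₀ ^ 2) :=
    Real.le_sqrt_of_sq_le (by nlinarith [sq_nonneg (D.margin x₀)])
  calc 1 - n * (D.μ.real {x₀} * D.margin x₀ ^ 2)
      _ = 1 + n * -(D.μ.real {x₀} * D.margin x₀ ^ 2) := by ring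
      _ ≤ (1 + -(D.μ.real {x₀} * D.margin x₀ ^ 2)) ^ n := one_add_mul_le_pow (by linarith) n
      _ ≤ affinity D.joint (D.flipAt x₀).joint ^ n := by
        refine pow_le_pow_left₀ (by linarith) ?_ n
        rw [affinity_joint_flipAt]
        nlinarith [measureReal_nonneg (μ := D.μ) (s := {x₀})]
      _ = affinity (D.sample n) ((D.flipAt x₀).sample n) := by
        simp only [sample, affinity_pi, Finset.prod_const, Finset.card_univ, Fintype.card_fin]

theorem mul_sample_real_ne_bayes_le_integral_excessOn [Finite X] (D : DGP X) {c : ℝ} {x₀ : X}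
    (hc : c ≤ D.margin x₀) {n : ℕ} (A : (Fin n → X × Bool) → X → Bool) :
    D.μ.real {x₀} * D.margin x₀ * (D.sample n).real {S | A S x₀ ≠ D.bayes x₀} ≤
      ∫ S, D.excessOn c (A S) ∂D.sample n := by
  let W := {S | A S x₀ ≠ D.bayes x₀}
  calc _ = ∫ S, W.indicator (fun _ => D.μ.real {x₀} * D.margin x₀) S ∂D.sample n := by
        rw [integral_indicator_const _ .of_discrete, smul_eq_mul, mul_comm]
    _ ≤ ∫ S, D.excessOn c (A S) ∂D.sample n := by
        exact integral_mono .of_finite .of_finite <| Set.indicator_le'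
          (fun S hS => D.mul_margin_le_excessOn hc .of_discrete hS)
          fun S _ => D.excessOn_nonneg c .of_discrete

theorem exists_le_integral_excessOn_of_sample_le [Finite X] (D : DGP X) {c : ℝ} {x₀ : X}
    (hm : 0 < D.margin x₀) (hc : c ≤ D.margin x₀) {n : ℕ}
    (hn : n * (D.μ.real {x₀} * D.margin x₀ ^ 2) ≤ 1 / 4) (A : (Fin n → X × Bool) → X → Bool) :
    ∃ D' ∈ ({D, D.flipAt x₀} : Set (DGP X)),
      D.μ.real {x₀} * D.margin x₀ / 8 ≤ ∫ S, D'.excessOn c (A S) ∂D'.sample n := by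
  have := Fintype.ofFinite X
  let D' := D.flipAt x₀
  let W := {S | A S x₀ ≠ D.bayes x₀}
  have hflip : {S | A S x₀ ≠ D'.bayes x₀} = Wᶜ := by
    ext S
    simp [W, D', D.bayes_flipAt_self hm]
  have err_le : D.μ.real {x₀} * D.margin x₀ * (D.sample n).real W ≤
      ∫ S, D.excessOn c (A S) ∂D.sample n :=
    D.mul_sample_real_ne_bayes_le_integral_excessOn hc A
  have err_le' : D.μ.real {x₀} * D.margin x₀ * (D'.sample n).real Wᶜ ≤
      ∫ S, D'.excessOn c (A S) ∂D'.sample n := by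
    have h := D'.mul_sample_real_ne_bayes_le_integral_excessOn (c := c) (x₀ := x₀)
      (by rwa [margin_flipAt]) A
    rwa [hflip, margin_flipAt] at h
  have err_ge : 1 / 4 ≤ (D.sample n).real W + (D'.sample n).real Wᶜ := by
    have hcam := affinity_sq_le (D.sample n) (D'.sample n) W
    have haff : 3 / 4 ≤ affinity (D.sample n) (D'.sample n) := by
      linarith [D.one_sub_le_affinity_sample_flipAt x₀ n]
    nlinarith
  have hmass : 0 ≤ D.μ.real {x₀} * D.margin x₀ := mul_nonneg measureReal_nonneg hm.le
  rcases le_total (1 / 8) ((D.sample n).real W) with h | h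
  · exact ⟨D, by simp, by nlinarith⟩
  · exact ⟨D', by simp [D'], by nlinarith⟩

end SinglePoint

section MarginFamily

variable {X : Type*} [MeasurableSpace X]

/-- The processes on `X` that are well specified for `F`, whose margin is `0` or larger than `c`
everywhere, and whose large-margin region has mass `p`. -/
def marginFamily (F : Set (X → Bool)) (c p : ℝ) : Set (DGP X) :=
  {D | D.bayes ∈ F ∧ (∀ x, D.margin x = 0 ∨ c < D.margin x) ∧ D.μ.real {x | c < D.margin x} = p}

theorem setOf_le_margin_eq_of_mem_marginFamily {D : DGP X} {F : Set (X → Bool)} {c p : ℝ}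
    (hc : 0 < c) (hD : D ∈ marginFamily F c p) : {x | c ≤ D.margin x} = {x | c < D.margin x} := by
  ext x
  rw [Set.mem_ofPred_eq, Set.mem_ofPred_eq]
  exact ⟨fun hx => (hD.2.1 x).resolve_left (hc.trans_le hx).ne', le_of_lt⟩

variable [MeasurableSingletonClass X]

theorem flipAt_mem_marginFamily {D : DGP X} {x₀ : X} {c p : ℝ}
    (hD : D ∈ marginFamily (trueOff x₀) c p) : D.flipAt x₀ ∈ marginFamily (trueOff x₀) c p := by
  obtain ⟨hbayes, hmargin, hmass⟩ := hD
  refine ⟨fun x hx => (D.bayes_flipAt_of_ne hx).trans (hbayes x hx), ?_, ?_⟩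
  · simpa only [margin_flipAt] using hmargin
  · simpa only [margin_flipAt, flipAt_μ] using hmass

theorem exists_isProbabilityMeasure_real_singleton {x₀ x₁ x₂ : X} (h₀₁ : x₁ ≠ x₀) (h₀₂ : x₂ ≠ x₀)
    (h₁₂ : x₁ ≠ x₂) {p q : ℝ} (hq : 0 ≤ q) (hqp : q ≤ p) (hp : p ≤ 1) :
    ∃ μ : Measure X, IsProbabilityMeasure μ ∧ μ.real {x₀} = q ∧ μ.real {x₂} = 1 - p := by
  let μ : Measure X := ENNReal.ofReal q • Measure.dirac x₀ +
    (ENNReal.ofReal (p - q) • Measure.dirac x₁ + ENNReal.ofReal (1 - p) • Measure.dirac x₂)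
  refine ⟨μ, ⟨?_⟩, ?_, ?_⟩
  · simp only [μ, Measure.add_apply, Measure.smul_apply, measure_univ, smul_eq_mul, mul_one]
    rw [← ENNReal.ofReal_add (by linarith) (by linarith),
      ← ENNReal.ofReal_add (by linarith) (by linarith)]
    simp
  · simp [μ, measureReal_def, h₀₁, h₀₂, hq]
  · simp [μ, measureReal_def, h₀₂.symm, h₁₂, hp]

theorem exists_mem_marginFamily_trueOff {x₀ x₁ x₂ : X} (h₀₁ : x₁ ≠ x₀) (h₀₂ : x₂ ≠ x₀)
    (h₁₂ : x₁ ≠ x₂) {c m p q : ℝ} (hc : 0 ≤ c) (hcm : c < m) (hm : m ≤ 1) (hq : 0 ≤ q)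
    (hqp : q ≤ p) (hp : p ≤ 1) :
    ∃ D ∈ marginFamily (trueOff x₀) c p, D.margin x₀ = m ∧ D.μ.real {x₀} = q := by
  classical
  obtain ⟨μ, hμ, mass_x₀, mass_x₂⟩ :=
    exists_isProbabilityMeasure_real_singleton h₀₁ h₀₂ h₁₂ hq hqp hp
  let D : DGP X :=
    { μ := μ
      prob := hμ
      η x := if x = x₂ then 1 / 2 else (1 + m) / 2
      measurable_η := .ite (.singleton x₂) measurable_const measurable_const
      η_mem x := by split_ifs <;> constructor <;> linarith }
  have margin_x₂ : D.margin x₂ = 0 := by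
    rw [margin_eq_abs]
    norm_num [D]
  have margin_of_ne {x : X} (hx : x ≠ x₂) : D.margin x = m := by
    rw [margin_eq_abs, abs_of_nonneg] <;> simp only [D, hx, if_false] <;> linarith
  have bayes_eq (x : X) : D.bayes x = true := by
    refine decide_eq_true ?_
    simp only [D]
    split_ifs <;> linarith
  have hregion : {x | c < D.margin x} = {x₂}ᶜ := by
    ext x
    by_cases hx : x = x₂
    · simp [hx, margin_x₂, hc]
    · simp [hx, margin_of_ne hx, hcm]
  refine ⟨D, ⟨fun x _ => bayes_eq x, fun x => ?_, ?_⟩, margin_of_ne h₀₂.symm, mass_x₀⟩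
  · by_cases hx : x = x₂
    · exact .inl (hx ▸ margin_x₂)
    · exact .inr (hcm.trans_eq (margin_of_ne hx).symm)
  · rw [hregion, probReal_compl_eq_one_sub (.singleton x₂)]
    simp [D, mass_x₂]

theorem exists_mem_marginFamily_le_integral_excessOn [Finite X] {x₀ x₁ x₂ : X} (h₀₁ : x₁ ≠ x₀)
    (h₀₂ : x₂ ≠ x₀) (h₁₂ : x₁ ≠ x₂) {c p : ℝ} (hc : c ∈ Set.Ioo 0 1) (hp : p ∈ Set.Ioc 0 1) {ε : ℝ}
    (hε : 0 < ε) (hεp : ε ≤ 1 / 128 * p * c ^ 2) {n : ℕ} (hn : n ≤ 1 / 128 / ε)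
    (A : (Fin n → X × Bool) → X → Bool) :
    ∃ D ∈ marginFamily (trueOff x₀) c p, ε ≤ c * ∫ S, D.excessOn c (A S) ∂D.sample n := by
  obtain ⟨hc0, hc1⟩ := hc
  obtain ⟨m, hcm, hm1, hm2⟩ : ∃ m, c < m ∧ m ≤ 1 ∧ m ≤ 2 * c :=
    ⟨min 1 (2 * c), lt_min hc1 (by linarith), min_le_left _ _, min_le_right _ _⟩
  -- Le Cam's bound is `q * m / 8` as long as `n * q * m ^ 2 ≤ 1 / 4`, and `m` is comparable to `c`.
  obtain ⟨q, hq⟩ : ∃ q, q * c ^ 2 = 8 * ε := ⟨8 * ε / c ^ 2, by field_simp⟩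
  have hm0 : 0 < m := hc0.trans hcm
  have hc2 : 0 < c ^ 2 := by positivity
  have hq0 : 0 ≤ q := nonneg_of_mul_nonneg_left (by linarith) hc2
  have hqp : q ≤ p := le_of_mul_le_mul_right (by nlinarith [mul_pos hp.1 hc2]) hc2
  obtain ⟨D, hD, hmargin, hmass⟩ :=
    exists_mem_marginFamily_trueOff h₀₁ h₀₂ h₁₂ hc0.le hcm hm1 hq0 hqp hp.2
  have hinfo : n * (q * m ^ 2) ≤ 1 / 4 := by
    calc n * (q * m ^ 2) ≤ n * (q * (2 * c) ^ 2) := by gcongr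
      _ = 32 * (n * ε) := by linear_combination 4 * n * hq
      _ ≤ 1 / 4 := by linarith [(le_div_iff₀ hε).1 hn]
  obtain ⟨D', hD', hle⟩ := D.exists_le_integral_excessOn_of_sample_le
    (hmargin ▸ hm0) (hmargin ▸ hcm.le) (by rwa [hmargin, hmass]) A
  refine ⟨D', ?_, ?_⟩
  · rcases hD' with rfl | rfl
    exacts [hD, flipAt_mem_marginFamily hD]
  · calc ε = c * (q * c / 8) := by linear_combination -hq / 8
      _ ≤ c * (q * m / 8) := by gcongr
      _ ≤ _ := by rw [hmargin, hmass] at hle; gcongr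

end MarginFamily

end DGP

theorem exp_neg_mul_div_two_le {ε δ x : ℝ} (hε : 0 < ε) (hδ : 0 < δ)
    (hx : 2 * Real.log (2 / δ) / ε ≤ x) : Real.exp (-(x * ε / 2)) ≤ δ := by
  rw [div_le_iff₀ hε] at hx
  calc Real.exp (-(x * ε / 2)) ≤ Real.exp (-Real.log (2 / δ)) := by gcongr; linarith
    _ = δ / 2 := by rw [Real.exp_neg, Real.exp_log (by positivity), inv_div]
    _ ≤ δ := by linarith

theorem mainTheorem5_general {X : Type*} [MeasurableSpace X] [MeasurableSingletonClass X] [Finite X]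
    {x₀ x₁ x₂ : X} (h₀₁ : x₁ ≠ x₀) (h₀₂ : x₂ ≠ x₀) (h₁₂ : x₁ ≠ x₂) {c p : ℝ}
    (hc : c ∈ Set.Ioo 0 1) (hp : p ∈ Set.Ioc 0 1) :
    (∀ ε : ℝ, 0 < ε → ε ≤ 1 / 128 * p * c ^ 2 → ∀ n : ℕ, (n : ℝ) ≤ 1 / 128 / ε →
      ∀ A : (Fin n → X × Bool) → (X → Bool), ∃ D ∈ DGP.marginFamily (trueOff x₀) c p,
        ε ≤ c * ∫ S, D.excessOn c (A S) ∂(D.sample n) ∧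
        ε / (c * D.μ.real {x | c < D.margin x}) ≤ ∫ S, D.condExcess c (A S) ∂(D.sample n)) ∧
    ∀ D ∈ DGP.marginFamily (trueOff x₀) c p, ∀ ε δ : ℝ, 0 < ε → 0 < δ → ∀ n : ℕ,
      2 * Real.log (2 / δ) / ε ≤ (n : ℝ) →
      (D.sample n).real {S | ∃ ω f, (∀ x, 0 ≤ ω x) ∧ ∫ x, (ω x - D.margin x) ^ 2 ∂D.μ ≤ ε ∧
        IsWeightedERM (trueOff x₀) ω S f ∧
        ε / (c * D.μ.real {x | c < D.margin x}) < D.condExcess c f} ≤ δ := by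
  constructor
  · intro ε hε hεp n hn A
    obtain ⟨D, hD, hle⟩ :=
      DGP.exists_mem_marginFamily_le_integral_excessOn h₀₁ h₀₂ h₁₂ hc hp hε hεp hn A
    refine ⟨D, hD, hle, ?_⟩
    simp only [DGP.condExcess_eq_div, integral_div,
      DGP.setOf_le_margin_eq_of_mem_marginFamily hc.1 hD]
    rw [← div_div]
    gcongr
    rwa [div_le_iff₀' hc.1]
  · intro D hD ε δ hε hδ n hn
    have hclass (f) (hf : f ∈ trueOff x₀) (x) (hx : x ≠ x₀) : f x = D.bayes x :=
      (hf x hx).trans (hD.1 x hx).symm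
    have := D.prob
    have hbound := D.sample_real_lt_condExcess_weightedERM_le hD.1 hclass hc.1 hε n
    rw [DGP.setOf_le_margin_eq_of_mem_marginFamily hc.1 hD] at hbound
    simp only [Integrable.of_finite, true_and] at hbound
    exact hbound.trans (exp_neg_mul_div_two_le hε hδ hn)

theorem mainTheorem5 :
    ∃ κ K : ℝ, 0 < κ ∧ 0 < K ∧
    ∃ (X : Type) (_ : MeasurableSpace X) (_ : DiscreteMeasurableSpace X) (_ : Finite X)
      (F : Set (X → Bool)) (G : Set (X → ℝ)),
      FiniteVCDim F ∧ FinitePseudoDim G ∧ (∀ g ∈ G, ∀ x, g x ∈ Set.Icc (0 : ℝ) 1) ∧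
      ∀ c p : ℝ, c ∈ Set.Ioo (0 : ℝ) 1 → p ∈ Set.Ioc (0 : ℝ) 1 →
      ∃ Θ : Set (DGP X),
        -- the DGPs are well specified, with a large-margin region of mass `p` and pure noise elsewhere
        (∀ D ∈ Θ, D.bayes ∈ F ∧ D.η ∈ G ∧ (∀ x, D.margin x = 0 ∨ c < D.margin x) ∧
          D.μ.real {x | c < D.margin x} = p) ∧
        -- lower bound for every learning rule, proper or not
        (∀ ε : ℝ, 0 < ε → ε ≤ κ * p * c ^ 2 → ∀ n : ℕ, (n : ℝ) ≤ κ / ε →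
          ∀ A : (Fin n → X × Bool) → (X → Bool), ∃ D ∈ Θ,
            ε ≤ c * ∫ S, D.excessOn c (A S) ∂(D.sample n) ∧
            ε / (c * D.μ.real {x | c < D.margin x}) ≤ ∫ S, D.condExcess c (A S) ∂(D.sample n)) ∧
        -- the matching upper bound, attained by weighted ERM with any accurate weight function
        -- (in particular with the margin function itself)
        (∀ D ∈ Θ, ∀ ε δ : ℝ, 0 < ε → 0 < δ → δ < 1 → ∀ n : ℕ,
          K * Real.log (2 / δ) / ε ≤ (n : ℝ) →
          ∀ ω : X → ℝ, (∀ x, ω x ∈ Set.Icc (0 : ℝ) 1) → ∫ x, (ω x - D.margin x) ^ 2 ∂D.μ ≤ ε →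
            (D.sample n).real {S | ∃ f, IsWeightedERM F ω S f ∧
              ε / (c * D.μ.real {x | c < D.margin x}) < D.condExcess c f} ≤ δ) := by
  refine ⟨1 / 128, 2, by norm_num, by norm_num, Fin 3, inferInstance, inferInstance,
    inferInstance, trueOff 0, {g | ∀ x, g x ∈ Set.Icc (0 : ℝ) 1},
    finiteVCDim_of_finite _, finitePseudoDim_of_finite _, fun g hg => hg, fun c p hc hp => ?_⟩
  obtain ⟨lower, upper⟩ := mainTheorem5_general (x₀ := (0 : Fin 3)) (x₁ := 1) (x₂ := 2)
    (by decide) (by decide) (by decide) hc hp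
  refine ⟨DGP.marginFamily (trueOff 0) c p, fun D hD => ⟨hD.1, D.η_mem, hD.2⟩, lower,
    fun D hD ε δ hε hδ _ n hn ω hω hωε => (measureReal_mono ?_).trans (upper D hD ε δ hε hδ n hn)⟩
  exact fun S ⟨f, hf⟩ => ⟨ω, f, fun x => (hω x).1, hωε, hf⟩
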